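/- Let $K$ be a field of characteristic $0$. An $L_\infty$-algebra over $K$ is a $\mathbb Z$-graded $K$-vector space $\mathfrak L$ with graded antisymmetric multilinear products $\mu_i$ of degree $2-i$, $i\ge 1$, such that for all $i\geq 1$ and homogeneous $a_1,\dots,a_i$ $$\sum_{j+k=i,\ j\ge1}\ \sum_{\sigma\in \mathrm{Sh}(j;i)}\chi(\sigma;a)(-1)^{k}\mu_{k+1}(\mu_j(a_{\sigma(1)},\ldots,a_{\sigma(j)}),a_{\sigma(j+1)},\ldots,a_{\sigma(i)})=0 ,$$ where $\mathrm{Sh}(j;i)$ is the set of unshuffles and $\chi$ is the Koszul sign, $a_1\wedge\dots\wedge a_i=\chi(\sigma;a)\,a_{\sigma(1)}\wedge\dots\wedge a_{\sigma(i)}$. Let $(\hat{\mathfrak L},\hat\mu_i)$ be an $L_\infty$-algebra, and let $\mathfrak L\subseteq\hat{\mathfrak L}$ be an $L_\infty$-subalgebra, i.e. a graded vector subspace on which all products close, with the restricted products $\mu_i$. Assume that the inclusion $\mathsf e:\mathfrak L\to\hat{\mathfrak L}$ is a quasi-isomorphism, i.e. induces an isomorphism on $\mu_1$-cohomology. Let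 $\mathsf p:\hat{\mathfrak L}\to\mathfrak L$ be a strict projection, i.e. a linear map of degree $0$ with $\mathsf p\circ\mathsf e=\mathrm{id}_{\mathfrak L}$ and $\mathsf p(\hat\mu_i(a_1,\dots,a_i))=\mu_i(\mathsf p(a_1),\dots,\mathsf p(a_i))$ for all $i\ge1$. Then $\mathsf p$ lifts to a homotopy transfer from $\hat{\mathfrak L}$ to $\mathfrak L$. That is, there is a linear map $\mathsf h:\hat{\mathfrak L}\to\hat{\mathfrak L}$ of degree $-1$ such that $(\mathsf p,\mathsf e,\mathsf h)$ is a special deformation retract, $$\mathrm{id}-\mathsf e\,\mathsf p=\hat\mu_1\mathsf h+\mathsf h\hat\mu_1,\quad \mathsf p\,\mathsf e=\mathrm{id},\quad \mathsf p\,\mathsf h=0,\quad \mathsf h\,\mathsf e=0,\quad \mathsf h\,\mathsf h=0,$$ and the transfer formulas $$\mathsf E_1=\mathsf e,\qquad \mathsf E_i(b_1,\ldots,b_i)=-\mathsf h\big(\Phi_i(b_1,\ldots,b_i)\big),\qquad \mu'_1=\mu_1,\qquad \mu'_i(b_1,\ldots,b_i)=\mathsf p\big(\Phi_i(b_1,\ldots,b_i)\big)\qquad(i\ge2),$$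 $$\Phi_i(b_1,\ldots,b_i)=\sum_{j=2}^i\frac1{j!}\sum_{\substack{k_1+\cdots+k_j=i\\ k_1,\ldots,k_j\ge1}}\ \sum_{\sigma\in\mathrm{Sh}(k_1,\ldots,k_{j-1};i)}\chi(\sigma;b)\,\zeta(\sigma;b)\,\hat\mu_j\big(\mathsf E_{k_1}(b_{\sigma(1)},\ldots,b_{\sigma(k_1)}),\ldots,\mathsf E_{k_j}(\ldots,b_{\sigma(i)})\big)$$ (for homogeneous $b_1,\dots,b_i\in\mathfrak L$, where $\mathrm{Sh}(k_1,\ldots,k_{j-1};i)$ is the set of permutations increasing on each of the consecutive blocks of lengths $k_1,\dots,k_j$, and $$\zeta(\sigma;b)=(-1)^{\sum_{1\le m<n\le j}k_mk_n+\sum_{m=1}^{j-1}k_m(j-m)+\sum_{m=2}^j(1-k_m)\sum_{k=1}^{k_1+\cdots+k_{m-1}}|b_{\sigma(k)}|}\ )$$ define an $L_\infty$-algebra structure $\mu'$ on $\mathfrak L$ and an $L_\infty$-quasi-isomorphism $\mathsf E:(\mathfrak L,\mu')\to(\hat{\mathfrak L},\hat\mu)$. Moreover, the transferred embedding has no higher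 components, $\mathsf E_i=0$ for all $i\ge2$, and the transfer reproduces the products on $\mathfrak L$: $\mu'_i=\mu_i$ for all $i\geq 1$. Here an $L_\infty$-quasi-isomorphism $\mathsf E$ is a family of graded antisymmetric multilinear maps $\mathsf E_i$ of degree $1-i$, $i\ge 1$, whose linear component induces an isomorphism on cohomology and which satisfies, for all $i\geq 1$ and homogeneous $b_1,\dots,b_i$, $$\sum_{j+k=i,\ j\ge1}\sum_{\sigma\in\mathrm{Sh}(j;i)}(-1)^{k}\chi(\sigma;b)\,\mathsf E_{k+1}(\mu'_j(b_{\sigma(1)},\ldots,b_{\sigma(j)}),b_{\sigma(j+1)},\ldots,b_{\sigma(i)})=\hat\mu_1(\mathsf E_i(b_1,\ldots,b_i))+\Phi_i(b_1,\ldots,b_i)\qquad(\Phi_1=0).$$ -/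

import Mathlib

/-! ## Cochain complexes of vector spaces -/

/-- A `ℤ`-graded vector space `V = ⨁ₖ Vₖ` with a differential of degree `1`. -/
structure GradedComplex (K V : Type*) [Field K] [AddCommGroup V] [Module K V] where
  /-- the subspace of homogeneous elements of degree `k` -/
  deg : ℤ → Submodule K V
  internal : DirectSum.IsInternal deg
  /-- the differential -/
  d : V →ₗ[K] V
  d_mem : ∀ (k : ℤ) (x : V), x ∈ deg k → d x ∈ deg (k + 1)
  d_d : ∀ x : V, d (d x) = 0

/-- A cochain map: linear, of degree `0`, commuting with the differentials. -/
structure IsCochainMap {K V W : Type*} [Field K] [AddCommGroup V] [Module K V]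
    [AddCommGroup W] [Module K W] (C : GradedComplex K V) (D : GradedComplex K W)
    (f : V →ₗ[K] W) : Prop where
  map_deg : ∀ (k : ℤ) (x : V), x ∈ C.deg k → f x ∈ D.deg k
  comm : ∀ x : V, f (C.d x) = D.d (f x)

/-- The (total) cohomology `ker d / im d`, i.e. the direct sum of the cohomology spaces in
all degrees. -/
abbrev GradedComplex.Cohomology {K V : Type*} [Field K] [AddCommGroup V] [Module K V]
    (C : GradedComplex K V) : Type _ :=
  LinearMap.ker C.d ⧸ (LinearMap.range C.d).submoduleOf (LinearMap.ker C.d)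

/-- The map induced by a cochain map on the cocycles. -/
def IsCochainMap.cocyclesMap {K V W : Type*} [Field K] [AddCommGroup V] [Module K V]
    [AddCommGroup W] [Module K W] {C : GradedComplex K V} {D : GradedComplex K W}
    {f : V →ₗ[K] W} (hf : IsCochainMap C D f) :
    LinearMap.ker C.d →ₗ[K] LinearMap.ker D.d :=
  f.restrict (fun x hx => by
    rw [LinearMap.mem_ker] at hx ⊢
    rw [← hf.comm, hx, map_zero])

/-- The map induced by a cochain map on cohomology. -/
def IsCochainMap.cohomologyMap {K V W : Type*} [Field K] [AddCommGroup V] [Module K V]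
    [AddCommGroup W] [Module K W] {C : GradedComplex K V} {D : GradedComplex K W}
    {f : V →ₗ[K] W} (hf : IsCochainMap C D f) : C.Cohomology →ₗ[K] D.Cohomology :=
  Submodule.mapQ _ _ hf.cocyclesMap (by
    rintro ⟨x, hx⟩ hx'
    obtain ⟨y, hy⟩ := hx'
    refine ⟨f y, ?_⟩
    rw [← hf.comm, hy]
    rfl)

/-- A quasi-isomorphism of cochain complexes: a cochain map that induces an isomorphism on
cohomology. -/
def IsQuasiIsoOfComplexes {K V W : Type*} [Field K] [AddCommGroup V] [Module K V]
    [AddCommGroup W] [Module K W] (C : GradedComplex K V) (D : GradedComplex K W)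
    (f : V →ₗ[K] W) : Prop :=
  ∃ hf : IsCochainMap C D f, Function.Bijective hf.cohomologyMap

/-! ## Signs and unshuffles -/

/-- The graded Koszul sign `χ(σ; a₁, …, aₙ)` for homogeneous elements of degrees `d₁, …, dₙ`,
`a₁ ∧ ⋯ ∧ aₙ = χ(σ; a₁, …, aₙ) a_{σ(1)} ∧ ⋯ ∧ a_{σ(n)}` with
`a ∧ b = -(-1)^{|a||b|} b ∧ a`: each inversion `p < q`, `σ(q) < σ(p)` contributes the factor
`-(-1)^{|a_{σ(p)}||a_{σ(q)}|}`. -/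
def koszulSign {n : ℕ} (σ : Equiv.Perm (Fin n)) (d : Fin n → ℤ) : ℤˣ :=
  ∏ p : Fin n, ∏ q : Fin n,
    if p < q ∧ σ q < σ p then -Int.negOnePow (d (σ p) * d (σ q)) else 1

/-- The `(j; n)`-unshuffles: `σ(1) < ⋯ < σ(j)` and `σ(j+1) < ⋯ < σ(n)`. -/
def unshuffles (n j : ℕ) : Finset (Equiv.Perm (Fin n)) :=
  {σ | ∀ p q : Fin n, p < q → (q.val < j ∨ j ≤ p.val) → σ p < σ q}

/-- The generalised unshuffles for `n = k₁ + ⋯ + kⱼ`: permutations that are increasing on each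
of the consecutive blocks of lengths `k₁, …, kⱼ`. -/
def blockUnshuffles {n : ℕ} (c : Composition n) : Finset (Equiv.Perm (Fin n)) :=
  {σ | ∀ (m : Fin c.length) (p q : Fin (c.blocksFun m)), p < q →
    σ (c.embedding m p) < σ (c.embedding m q)}

/-- The sign `ζ` for `n = k₁ + ⋯ + kⱼ`, with exponent
`∑_{m<m'} kₘ kₘ' + ∑ₘ kₘ (j - m) + ∑ₘ (1 - kₘ) ∑_{r ≤ k₁ + ⋯ + k_{m-1}} |a_{σ(r)}|`
(indices start at `0` in the code, so `j - m` becomes `j - 1 - m`). -/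
def zetaSign {n : ℕ} (c : Composition n) (σ : Equiv.Perm (Fin n)) (d : Fin n → ℤ) : ℤˣ :=
  Int.negOnePow
    ((∑ m : Fin c.length, ∑ m' : Fin c.length,
        if m < m' then (c.blocksFun m : ℤ) * (c.blocksFun m' : ℤ) else 0)
      + (∑ m : Fin c.length, (c.blocksFun m : ℤ) * ((c.length : ℤ) - 1 - (m.val : ℤ)))
      + (∑ m : Fin c.length, (1 - (c.blocksFun m : ℤ)) *
          ∑ r : Fin n, if r.val < c.sizeUpTo m.val then d (σ r) else 0))

/-- `∑_{j+k=n} ∑_{σ ∈ Sh(j;n)} χ(σ; a) (-1)^k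
  φ_{k+1}(μⱼ(a_{σ(1)}, …, a_{σ(j)}), a_{σ(j+1)}, …, a_{σ(n)})`,
for `a₁, …, aₙ` of degrees `d₁, …, dₙ`. The sum includes `j = 0`; this term vanishes for the
families used below, for which `μ₀ = 0`. -/
def unshuffleSum {K V W : Type*} [Field K] [AddCommGroup V] [Module K V]
    [AddCommGroup W] [Module K W]
    (φ : (i : ℕ) → MultilinearMap K (fun _ : Fin i => V) W)
    (μ : (i : ℕ) → MultilinearMap K (fun _ : Fin i => V) V)
    {n : ℕ} (d : Fin n → ℤ) (a : Fin n → V) : W :=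
  ∑ j : Fin (n + 1), ∑ σ ∈ unshuffles n j,
    (koszulSign σ d * (-1) ^ (n - j.val)) •
      φ (n - j.val + 1) (Fin.cons
        (μ j.val (fun p : Fin j.val => a (σ ⟨p.val, by omega⟩)))
        (fun q : Fin (n - j.val) => a (σ ⟨j.val + q.val, by omega⟩)))

/-- For `n = k₁ + ⋯ + kⱼ` and maps `F₁, …, Fⱼ` in `k₁, …, kⱼ` arguments (which may also depend
on the degrees of these arguments), the sum
`1/j! ∑_{σ ∈ Sh(k₁,…,k_{j-1};n)} χ(σ; a) ζ(σ; a)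
  μⱼ(F₁(a_{σ(1)}, …, a_{σ(k₁)}), …, Fⱼ(…, a_{σ(n)}))`,
for `a₁, …, aₙ` of degrees `d₁, …, dₙ`. -/
noncomputable def blockSum {K V W : Type*} [Field K] [AddCommGroup V] [Module K V]
    (μ : (i : ℕ) → MultilinearMap K (fun _ : Fin i => V) V)
    {n : ℕ} (c : Composition n)
    (F : (m : Fin c.length) → (Fin (c.blocksFun m) → ℤ) → (Fin (c.blocksFun m) → W) → V)
    (d : Fin n → ℤ) (a : Fin n → W) : V :=
  ((c.length.factorial : K)⁻¹) • ∑ σ ∈ blockUnshuffles c,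
    (koszulSign σ d * zetaSign c σ d) •
      μ c.length (fun m => F m (fun r => d (σ (c.embedding m r)))
        (fun r => a (σ (c.embedding m r))))

/-! ## `L_∞`-algebras -/

/-- An `L_∞`-algebra structure on the vector space `V`: a grading and graded antisymmetric
multilinear products `μᵢ` of degree `2 - i` for `i ≥ 1` (with the dummy value `μ₀ = 0`),
satisfying the homotopy Jacobi identities. -/
structure LInftyAlgebra (K V : Type*) [Field K] [AddCommGroup V] [Module K V] where
  /-- the subspace of homogeneous elements of degree `k` -/
  deg : ℤ → Submodule K V
  internal : DirectSum.IsInternal deg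
  /-- the higher products -/
  μ : (i : ℕ) → MultilinearMap K (fun _ : Fin i => V) V
  μ_zero : μ 0 = 0
  μ_mem : ∀ (i : ℕ) (d : Fin i → ℤ) (a : Fin i → V), (∀ r, a r ∈ deg (d r)) →
    μ i a ∈ deg ((∑ r, d r) + (2 - (i : ℤ)))
  μ_antisymm : ∀ (i : ℕ) (d : Fin i → ℤ) (a : Fin i → V), (∀ r, a r ∈ deg (d r)) →
    ∀ σ : Equiv.Perm (Fin i), μ i a = koszulSign σ d • μ i (fun r => a (σ r))
  jacobi : ∀ (i : ℕ) (d : Fin i → ℤ) (a : Fin i → V), (∀ r, a r ∈ deg (d r)) →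
    unshuffleSum μ μ d a = 0

namespace LInftyAlgebra

variable {K V W : Type*} [Field K] [AddCommGroup V] [Module K V] [AddCommGroup W] [Module K W]

/-- The differential `μ₁` as a linear map. -/
def differential (L : LInftyAlgebra K V) : V →ₗ[K] V :=
  (MultilinearMap.ofSubsingleton K V V (0 : Fin 1)).symm (L.μ 1)

theorem differential_apply (L : LInftyAlgebra K V) (x : V) :
    L.differential x = L.μ 1 (fun _ => x) := rfl

theorem differential_differential_of_mem (L : LInftyAlgebra K V) {k : ℤ} {x : V}
    (hx : x ∈ L.deg k) : L.differential (L.differential x) = 0 := by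
  have h := L.jacobi 1 (fun _ => k) (fun _ => x) (fun _ => hx)
  have h1 : unshuffles 1 1 = {1} := by decide
  have hs : koszulSign (1 : Equiv.Perm (Fin 1)) (fun _ => k) = 1 := by
    simp [koszulSign]
  unfold unshuffleSum at h
  rw [Fin.sum_univ_two] at h
  have h0 : ∀ a, L.μ (0 : Fin 2).val a = 0 := by
    intro a
    show L.μ 0 a = 0
    rw [L.μ_zero]; rfl
  rw [Finset.sum_eq_zero, zero_add] at h
  · change (∑ σ ∈ unshuffles 1 1, _) = _ at h
    rw [h1, Finset.sum_singleton, hs] at h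
    rw [differential_apply, differential_apply]
    simp only [one_mul] at h
    change ((1 : ℤˣ) • L.μ 1 _ : V) = 0 at h
    rw [one_smul] at h
    rw [← h]
    congr 1
    funext r
    have : r = 0 := Subsingleton.elim _ _
    subst this
    rfl
  · intro σ _
    rw [h0]
    rw [MultilinearMap.map_coord_zero _ 0 (Fin.cons_zero _ _), smul_zero]

/-- The cochain complex `(L, μ₁)` underlying an `L_∞`-algebra. -/
def complex (L : LInftyAlgebra K V) : GradedComplex K V where
  deg := L.deg
  internal := L.internal
  d := L.differential
  d_mem := by
    intro k x hx
    have := L.μ_mem 1 (fun _ => k) (fun _ => x) (fun _ => hx)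
    simpa [differential_apply] using this
  d_d := by
    intro x
    have hx : x ∈ ⨆ k, L.deg k := by
      rw [L.internal.submodule_iSup_eq_top]; trivial
    induction hx using Submodule.iSup_induction' with
    | mem k x hx => exact L.differential_differential_of_mem hx
    | zero => simp
    | add x y _ _ hx hy => rw [map_add, map_add, hx, hy, add_zero]

/-- Strict morphisms of `L_∞`-algebras: cochain maps that respect all products. -/
structure IsStrictMorphism (L : LInftyAlgebra K V) (M : LInftyAlgebra K W)
    (f : V →ₗ[K] W) : Prop where
  isCochainMap : IsCochainMap L.complex M.complex f
  map_μ : ∀ (i : ℕ) (a : Fin i → V), M.μ i (fun r => f (a r)) = f (L.μ i a)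

/-- (Weak) morphisms of `L_∞`-algebras: graded antisymmetric multilinear maps `φᵢ` of degree
`1 - i` for `i ≥ 1` (with the dummy value `φ₀ = 0`), compatible with the products. -/
structure Morphism (L : LInftyAlgebra K V) (M : LInftyAlgebra K W) where
  /-- the component maps -/
  φ : (i : ℕ) → MultilinearMap K (fun _ : Fin i => V) W
  φ_zero : φ 0 = 0
  φ_mem : ∀ (i : ℕ) (d : Fin i → ℤ) (a : Fin i → V), (∀ r, a r ∈ L.deg (d r)) →
    φ i a ∈ M.deg ((∑ r, d r) + (1 - (i : ℤ)))
  φ_antisymm : ∀ (i : ℕ) (d : Fin i → ℤ) (a : Fin i → V), (∀ r, a r ∈ L.deg (d r)) →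
    ∀ σ : Equiv.Perm (Fin i), φ i a = koszulSign σ d • φ i (fun r => a (σ r))
  compat : ∀ (i : ℕ) (d : Fin i → ℤ) (a : Fin i → V), (∀ r, a r ∈ L.deg (d r)) →
    unshuffleSum φ L.μ d a
      = ∑ c : Composition i, blockSum M.μ c (fun m _ => φ (c.blocksFun m)) d a

/-- The linear component `φ₁` of a morphism. -/
def Morphism.linear {L : LInftyAlgebra K V} {M : LInftyAlgebra K W} (f : Morphism L M) :
    V →ₗ[K] W :=
  (MultilinearMap.ofSubsingleton K V W (0 : Fin 1)).symm (f.φ 1)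

/-- A quasi-isomorphism of `L_∞`-algebras: a morphism whose linear component induces an
isomorphism on cohomology. -/
def Morphism.IsQuasiIso {L : LInftyAlgebra K V} {M : LInftyAlgebra K W} (f : Morphism L M) :
    Prop :=
  IsQuasiIsoOfComplexes L.complex M.complex f.linear

/-- An `L_∞`-subalgebra: a graded vector subspace on which the products close. -/
structure Subalgebra (L : LInftyAlgebra K V) where
  /-- the underlying subspace -/
  carrier : Submodule K V
  graded : carrier ≤ ⨆ k : ℤ, carrier ⊓ L.deg k
  closed : ∀ (i : ℕ) (a : Fin i → V), (∀ r, a r ∈ carrier) → L.μ i a ∈ carrier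

namespace Subalgebra

variable {L : LInftyAlgebra K V}

/-- The products restricted to a subalgebra. -/
def restrictedProduct (S : L.Subalgebra) (i : ℕ) :
    MultilinearMap K (fun _ : Fin i => S.carrier) S.carrier :=
  ((L.μ i).compLinearMap (fun _ => S.carrier.subtype)).codRestrict S.carrier
    (fun a => S.closed i _ (fun r => (a r).2))

theorem coe_restrictedProduct (S : L.Subalgebra) (i : ℕ) (a : Fin i → S.carrier) :
    (S.restrictedProduct i a : V) = L.μ i (fun r => (a r : V)) := rfl

theorem coe_units_smul (S : L.Subalgebra) (u : ℤˣ) (x : S.carrier) :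
    ((u • x : S.carrier) : V) = u • (x : V) := by
  simp [Units.smul_def]

theorem coe_unshuffleSum (S : L.Subalgebra) {n : ℕ} (d : Fin n → ℤ) (a : Fin n → S.carrier) :
    ((unshuffleSum S.restrictedProduct S.restrictedProduct d a : S.carrier) : V)
      = unshuffleSum L.μ L.μ d (fun r => (a r : V)) := by
  unfold unshuffleSum
  rw [Submodule.coe_sum]
  refine Finset.sum_congr rfl fun j _ => ?_
  rw [Submodule.coe_sum]
  refine Finset.sum_congr rfl fun σ _ => ?_
  rw [coe_units_smul, coe_restrictedProduct]
  congr 2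
  funext r
  refine Fin.cases ?_ (fun q => ?_) r
  · simp [coe_restrictedProduct]
  · simp

theorem isInternal_comap (S : L.Subalgebra) :
    DirectSum.IsInternal (fun k => (L.deg k).comap S.carrier.subtype) := by
  rw [DirectSum.isInternal_submodule_iff_iSupIndep_and_iSup_eq_top]
  constructor
  · intro k
    rw [Submodule.disjoint_def]
    intro x hx hx'
    have hd := (Submodule.disjoint_def.mp (L.internal.submodule_iSupIndep k)) (x : V) hx
    apply Subtype.ext
    refine hd ?_
    have hm : (x : V) ∈ (⨆ j, ⨆ (_ : j ≠ k), (L.deg j).comap S.carrier.subtype).map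
        S.carrier.subtype := ⟨x, hx', rfl⟩
    simp only [Submodule.map_iSup] at hm
    exact (show _ ≤ _ from iSup₂_mono fun j _ => Submodule.map_comap_le _ _) hm
  · rw [eq_top_iff]
    intro x _
    have hx : (x : V) ∈ (⨆ k, (L.deg k).comap S.carrier.subtype).map S.carrier.subtype := by
      rw [Submodule.map_iSup]
      have hle : (⨆ k, S.carrier ⊓ L.deg k) ≤
          ⨆ k, ((L.deg k).comap S.carrier.subtype).map S.carrier.subtype := iSup_mono ?_
      · exact hle (S.graded x.2)
      intro k
      rintro y ⟨hy, hy'⟩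
      exact ⟨⟨y, hy⟩, hy', rfl⟩
    obtain ⟨y, hy, hxy⟩ := hx
    rwa [← Subtype.ext hxy]

/-- A subalgebra with the restricted grading and products is an `L_∞`-algebra. -/
def toLInftyAlgebra (S : L.Subalgebra) : LInftyAlgebra K S.carrier where
  deg k := (L.deg k).comap S.carrier.subtype
  internal := S.isInternal_comap
  μ := S.restrictedProduct
  μ_zero := by
    ext a
    rw [coe_restrictedProduct, L.μ_zero]
    rfl
  μ_mem := fun i d a ha => L.μ_mem i d (fun r => (a r : V)) ha
  μ_antisymm := by
    intro i d a ha σ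
    apply Subtype.ext
    rw [coe_units_smul, coe_restrictedProduct, coe_restrictedProduct]
    exact L.μ_antisymm i d (fun r => (a r : V)) ha σ
  jacobi := by
    intro i d a ha
    apply Subtype.ext
    rw [coe_unshuffleSum]
    exact L.jacobi i d (fun r => (a r : V)) ha

end Subalgebra

end LInftyAlgebra

/-! ## Homotopy transfer -/

/-- Special deformation retracts: cochain maps `p : C → D` and `e : D → C` and a linear map
`h : C → C` of degree `-1` with `id - e p = d h + h d`, `p e = id` and the side conditions
`p h = 0`, `h e = 0`, `h h = 0`. -/
structure IsSpecialDeformationRetract {K V W : Type*} [Field K] [AddCommGroup V] [Module K V]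
    [AddCommGroup W] [Module K W] (C : GradedComplex K V) (D : GradedComplex K W)
    (p : V →ₗ[K] W) (e : W →ₗ[K] V) (h : V →ₗ[K] V) : Prop where
  p_cochain : IsCochainMap C D p
  e_cochain : IsCochainMap D C e
  h_deg : ∀ (k : ℤ) (x : V), x ∈ C.deg k → h x ∈ C.deg (k - 1)
  homotopy : LinearMap.id - e ∘ₗ p = C.d ∘ₗ h + h ∘ₗ C.d
  p_comp_e : p ∘ₗ e = LinearMap.id
  p_comp_h : p ∘ₗ h = 0
  h_comp_e : h ∘ₗ e = 0
  h_comp_h : h ∘ₗ h = 0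

theorem Composition.blocksFun_lt_of_two_le {n : ℕ} (c : Composition n) (hc : 2 ≤ c.length)
    (m : Fin c.length) : c.blocksFun m < n := by
  have hn : 0 < n := by
    have := c.length_le
    omega
  refine (Composition.ne_single_iff hn).mp ?_ m
  rintro rfl
  simp at hc

/-- The components of the transferred embedding, evaluated on `b₁, …, bᵢ` of degrees
`d₁, …, dᵢ`: `E₁ = e` and, recursively,
`Eᵢ(b₁, …, bᵢ) = -∑_{j=2}^i 1/j! ∑_{k₁+⋯+kⱼ=i} ∑_σ χ ζ h(μⱼ(E_{k₁}(…), …, E_{kⱼ}(…)))`. -/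
noncomputable def transferEmbedding {K V W : Type*} [Field K] [AddCommGroup V] [Module K V]
    [AddCommGroup W] [Module K W] (L : LInftyAlgebra K V) (e : W →ₗ[K] V) (h : V →ₗ[K] V) :
    (i : ℕ) → (Fin i → ℤ) → (Fin i → W) → V
  | 0, _, _ => 0
  | 1, _, b => e (b 0)
  | n + 2, d, b =>
    -∑ c : {c : Composition (n + 2) // 2 ≤ c.length},
      h (blockSum L.μ c.1 (fun m d' b' =>
        transferEmbedding L e h (c.1.blocksFun m) d' b') d b)
  termination_by i => i
  decreasing_by exact c.1.blocksFun_lt_of_two_le c.2 m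

/-- The transferred products for `i ≥ 2`, evaluated on `b₁, …, bᵢ` of degrees `d₁, …, dᵢ`:
`∑_{j=2}^i 1/j! ∑_{k₁+⋯+kⱼ=i} ∑_σ χ ζ p(μⱼ(E_{k₁}(…), …, E_{kⱼ}(…)))`. -/
noncomputable def transferProduct {K V W : Type*} [Field K] [AddCommGroup V] [Module K V]
    [AddCommGroup W] [Module K W] (L : LInftyAlgebra K V) (p : V →ₗ[K] W) (e : W →ₗ[K] V)
    (h : V →ₗ[K] V) (i : ℕ) (d : Fin i → ℤ) (b : Fin i → W) : W :=
  ∑ c : {c : Composition i // 2 ≤ c.length},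
    p (blockSum L.μ c.1 (fun m => transferEmbedding L e h (c.1.blocksFun m)) d b)

/-- The `L_∞`-algebra `M` and the morphism `E : M → L` are obtained from the `L_∞`-algebra `L`
by homotopy transfer along the special deformation retract `(p, e, h)` from the complex of `L`
to the complex `D`: the complex underlying `M` is `D`, the higher products of `M` and the
components of `E` are given by the transfer formulas, and `E` is a quasi-isomorphism. -/
structure IsHomotopyTransfer {K V W : Type*} [Field K] [AddCommGroup V] [Module K V]
    [AddCommGroup W] [Module K W] (L : LInftyAlgebra K V) (D : GradedComplex K W)
    (p : V →ₗ[K] W) (e : W →ₗ[K] V) (h : V →ₗ[K] V)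
    (M : LInftyAlgebra K W) (E : LInftyAlgebra.Morphism M L) : Prop where
  retract : IsSpecialDeformationRetract L.complex D p e h
  complex_eq : M.complex = D
  product_eq : ∀ i : ℕ, 2 ≤ i → ∀ (d : Fin i → ℤ) (b : Fin i → W),
    (∀ r, b r ∈ D.deg (d r)) → M.μ i b = transferProduct L p e h i d b
  embedding_eq : ∀ i : ℕ, 1 ≤ i → ∀ (d : Fin i → ℤ) (b : Fin i → W),
    (∀ r, b r ∈ D.deg (d r)) → E.φ i b = transferEmbedding L e h i d b
  quasiIso : E.IsQuasiIso

/-! ## Gluing linear maps and constructing homotopies -/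

/-! The whole statement follows from `h` vanishing on the subalgebra. All arguments of the transfer
recursion lie in the subalgebra, which is closed under the products, so the argument of `h` lies
there too and is killed by `h e = 0`. Hence `E_i = 0` for `i ≥ 2`
(`transferEmbedding_mem_and_eq_zero`). In the transferred product only the composition into ones
survives; its `i!` permutations give equal terms that cancel the factor `1/i!`, and what remains is
`p` of a product in the subalgebra, on which `p` is the identity (`transferProduct_eq`). So the
transferred structure is the given one, and the embedding is the strict inclusion
(`IsStrictMorphism.toMorphism`); no general transfer theorem is needed.

It remains to find `h`. Since `e` is a quasi-isomorphism, `ker p` is an acyclic complement of the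
image of `e`, and over a field an acyclic complex is contractible. The contraction is built from a
generalised inverse of the differential on `ker p`, corrected so that it squares to zero, and
extended by zero on the image of `e`. -/

/-- A family of linear maps indexed by the degrees of an internal grading glues to one linear map
that agrees with the `k`-th member of the family in degree `k`. -/
theorem DirectSum.IsInternal.exists_linearMap_eq {ι K V W : Type*} [DecidableEq ι] [Field K]
    [AddCommGroup V] [Module K V] [AddCommGroup W] [Module K W] {A : ι → Submodule K V}
    (hA : DirectSum.IsInternal A) (t : ι → V →ₗ[K] W) :
    ∃ f : V →ₗ[K] W, ∀ k, ∀ x ∈ A k, f x = t k x := by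
  let φ := LinearEquiv.ofBijective (DirectSum.coeLinearMap A) hA
  refine ⟨DirectSum.toModule K ι W (fun k => t k ∘ₗ (A k).subtype) ∘ₗ φ.symm.toLinearMap, ?_⟩
  intro k x hx
  have h : φ.symm x = DirectSum.lof K ι (fun k => A k) k ⟨x, hx⟩ := by
    rw [LinearEquiv.symm_apply_eq]
    exact (DirectSum.coeLinearMap_lof A k ⟨x, hx⟩).symm
  simp [h]

theorem DirectSum.IsInternal.linearMap_ext {ι K V W : Type*} [DecidableEq ι] [Field K]
    [AddCommGroup V] [Module K V] [AddCommGroup W] [Module K W] {A : ι → Submodule K V}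
    (hA : DirectSum.IsInternal A) {f g : V →ₗ[K] W} (h : ∀ k, ∀ x ∈ A k, f x = g x) : f = g := by
  ext x
  have hx : x ∈ ⨆ k, A k := by
    rw [hA.submodule_iSup_eq_top]; trivial
  induction hx using Submodule.iSup_induction' with
  | mem k x hx => exact h k x hx
  | zero => simp
  | add x y _ _ hx hy => rw [map_add, map_add, hx, hy]

/-- A linear map over a field, restricted to a subspace `N`, has a generalised inverse with
values in `N`. -/
theorem LinearMap.exists_generalizedInverse_on {K V W : Type*} [Field K] [AddCommGroup V]
    [Module K V] [AddCommGroup W] [Module K W] (f : V →ₗ[K] W) (N : Submodule K V) :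
    ∃ t : W →ₗ[K] V, (∀ y, t y ∈ N) ∧ ∀ x ∈ N, f (t (f x)) = f x := by
  obtain ⟨s, hs⟩ := (f.domRestrict N).rangeRestrict.exists_rightInverse_of_surjective
    (LinearMap.range_rangeRestrict _)
  obtain ⟨t, ht⟩ := LinearMap.exists_extend s
  refine ⟨N.subtype ∘ₗ t, fun y => (t y).2, fun x hx => ?_⟩
  have h1 := LinearMap.congr_fun ht ((f.domRestrict N).rangeRestrict ⟨x, hx⟩)
  have h2 := LinearMap.congr_fun hs ((f.domRestrict N).rangeRestrict ⟨x, hx⟩)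
  rw [LinearMap.comp_apply, ← h1] at h2
  exact congrArg Subtype.val h2

/-- If a cochain map `e` with a cochain retraction `p` is surjective on cohomology, then every
cocycle in the kernel of `p` is the coboundary of an element of this kernel. -/
theorem IsQuasiIsoOfComplexes.exists_primitive {K V W : Type*} [Field K] [AddCommGroup V]
    [Module K V] [AddCommGroup W] [Module K W] {C : GradedComplex K V} {D : GradedComplex K W}
    {p : V →ₗ[K] W} {e : W →ₗ[K] V} (he : IsQuasiIsoOfComplexes D C e) (hp : IsCochainMap C D p)
    (hpe : ∀ y, p (e y) = y) {x : V} (hpx : p x = 0) (hdx : C.d x = 0) :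
    ∃ y, p y = 0 ∧ C.d y = x := by
  obtain ⟨hc, hb⟩ := he
  obtain ⟨z, hz⟩ := hb.2 (Submodule.Quotient.mk ⟨x, hdx⟩)
  obtain ⟨⟨z, hz0⟩, rfl⟩ := Submodule.Quotient.mk_surjective _ z
  have hz' := (Submodule.Quotient.eq _).1 hz
  obtain ⟨w, hw⟩ := hz'
  have hw' : C.d w = e z - x := hw
  -- `-w` is a primitive of `x` up to `e z`; adding `e (p w)` both cancels that term and moves the
  -- primitive into `ker p`.
  refine ⟨e (p w) - w, by simp [hpe], ?_⟩
  have h1 : D.d (p w) = z := by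
    rw [← hp.comm, hw', map_sub, hpe, hpx, sub_zero]
  rw [map_sub, ← hc.comm, h1, hw']
  abel

/-- A cochain retraction of a quasi-isomorphism over a field is part of a special deformation
retract. -/
theorem IsQuasiIsoOfComplexes.exists_isSpecialDeformationRetract {K V W : Type*} [Field K]
    [AddCommGroup V] [Module K V] [AddCommGroup W] [Module K W] {C : GradedComplex K V}
    {D : GradedComplex K W} {p : V →ₗ[K] W} {e : W →ₗ[K] V} (he : IsQuasiIsoOfComplexes D C e)
    (hp : IsCochainMap C D p) (hpe : p ∘ₗ e = LinearMap.id) :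
    ∃ h : V →ₗ[K] V, IsSpecialDeformationRetract C D p e h := by
  have hpe' : ∀ y, p (e y) = y := fun y => LinearMap.congr_fun hpe y
  have hec : IsCochainMap D C e := he.1
  -- The inverse is chosen degree by degree, so that the glued map `g` is homogeneous of degree `-1`
  -- with values in `ker p`.
  choose t ht htd using fun k : ℤ =>
    C.d.exists_generalizedInverse_on (LinearMap.ker p ⊓ C.deg (k - 1))
  obtain ⟨g, hg⟩ := C.internal.exists_linearMap_eq t
  have hpg : ∀ x, p (g x) = 0 := by
    refine fun x => LinearMap.congr_fun (f := p ∘ₗ g) (g := 0)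
      (C.internal.linearMap_ext fun k x hx => ?_) x
    simpa [hg k x hx] using (ht k x).1
  have hgdeg : ∀ k x, x ∈ C.deg k → g x ∈ C.deg (k - 1) := fun k x hx => by
    rw [hg k x hx]; exact (ht k x).2
  set q : V →ₗ[K] V := LinearMap.id - e ∘ₗ p
  have hqx : ∀ x, q x = x - e (p x) := fun x => rfl
  have hpq : ∀ x, p (q x) = 0 := fun x => by simp [hqx, hpe']
  have hqN : ∀ x, p x = 0 → q x = x := fun x hx => by simp [hqx, hx]
  have hqd : ∀ x, q (C.d x) = C.d (q x) := fun x => by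
    rw [hqx, hqx, hp.comm, hec.comm, map_sub]
  have hqdeg : ∀ k x, x ∈ C.deg k → q x ∈ C.deg k := fun k x hx =>
    sub_mem hx (hec.map_deg k _ (hp.map_deg k x hx))
  have hdgd : ∀ y, p y = 0 → C.d (g (C.d y)) = C.d y := by
    intro y hy
    -- Precomposing with the projection `q` onto `ker p` turns the claim into an equality of maps on
    -- all of `V`, which may be tested on homogeneous elements.
    have := LinearMap.congr_fun (f := C.d ∘ₗ g ∘ₗ C.d ∘ₗ q) (g := C.d ∘ₗ q)
      (C.internal.linearMap_ext fun k x hx => ?_) y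
    · simpa [hqN y hy] using this
    · have h1 := hqdeg k x hx
      have h2 := htd (k + 1) (q x) ⟨hpq x, by simpa using h1⟩
      simpa [hg (k + 1) _ (C.d_mem k _ h1)] using h2
  have hcocycle : ∀ x, p x = 0 → C.d x = 0 → C.d (g x) = x := by
    intro x hx hdx
    obtain ⟨y, hy, rfl⟩ := he.exists_primitive hp hpe' hx hdx
    exact hdgd y hy
  have hpd : ∀ x, p x = 0 → p (C.d x) = 0 := fun x hx => by rw [hp.comm, hx, map_zero]
  -- `P` is idempotent, and by `hcocycle` its image is exactly the space of cocycles in `ker p`.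
  set P : V →ₗ[K] V := C.d ∘ₗ g
  have hPx : ∀ x, P x = C.d (g x) := fun x => rfl
  have hPP : ∀ x, P (P x) = P x := fun x => hdgd _ (hpg x)
  have hpP : ∀ x, p (P x) = 0 := fun x => hpd _ (hpg x)
  have hdP : ∀ x, C.d (P x) = 0 := fun x => C.d_d _
  have hPdeg : ∀ k x, x ∈ C.deg k → P x ∈ C.deg k := fun k x hx => by
    simpa [hPx] using C.d_mem _ _ (hgdeg k x hx)
  -- The right factor `P` applies `g` only to cocycles, giving `d h = P q`. The left factor `id - P`
  -- makes `P h = 0`, hence `h h = 0`. Acyclicity gives `h d = (id - P) q`, and the two add up to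
  -- `q`.
  let h : V →ₗ[K] V := (LinearMap.id - P) ∘ₗ g ∘ₗ P ∘ₗ q
  have hx' : ∀ x, h x = g (P (q x)) - P (g (P (q x))) := fun x => rfl
  have hph : ∀ x, p (h x) = 0 := fun x => by rw [hx', map_sub, hpg, hpP, sub_zero]
  refine ⟨h, hp, hec, ?_, ?_, hpe, ?_, ?_, ?_⟩
  · intro k x hx
    have h1 := hgdeg k _ (hPdeg k _ (hqdeg k x hx))
    exact sub_mem h1 (hPdeg _ _ h1)
  · ext x
    change q x = C.d (h x) + h (C.d x)
    have h1 : C.d (h x) = P (q x) := by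
      rw [hx', map_sub, hdP, sub_zero, ← hPx, hPP]
    have h2 : P (C.d (q x)) = C.d (q x) := hdgd _ (hpq x)
    -- `q x - g (d (q x))` is a cocycle in `ker p`, so `id - P` takes the same value on `q x` and on
    -- `g (d (q x))`.
    have h3 : P (q x - g (C.d (q x))) = q x - g (C.d (q x)) := by
      refine hcocycle _ (by rw [map_sub, hpq, hpg, sub_zero]) ?_
      rw [map_sub, hdgd _ (hpq x), sub_self]
    rw [map_sub] at h3
    rw [h1, hx', hqd, h2]
    rw [eq_comm, ← sub_eq_zero, ← sub_eq_zero.2 h3]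
    abel
  · exact LinearMap.ext hph
  · ext x
    change h (e x) = 0
    have : q (e x) = 0 := by rw [hqx, hpe', sub_self]
    simp [hx', this]
  · ext x
    change h (h x) = 0
    have : P (h x) = 0 := by rw [hx' x, map_sub, hPP, sub_self]
    rw [hx' (h x), hqN _ (hph x), this]
    simp

/-! ## Unshuffle sums and block sums of maps concentrated in arity one -/

theorem koszulSign_one {n : ℕ} (d : Fin n → ℤ) : koszulSign 1 d = 1 := by
  refine Finset.prod_eq_one fun p _ => Finset.prod_eq_one fun q _ => if_neg ?_
  simp only [Equiv.Perm.coe_one, id_eq, not_and, not_lt]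
  exact fun h => h.le

theorem unshuffles_self (n : ℕ) : unshuffles n n = {1} := by
  ext σ
  simp only [unshuffles, Finset.mem_filter, Finset.mem_univ, true_and, Finset.mem_singleton]
  constructor
  · intro h
    have hσ : StrictMono σ := fun p q hpq => h p q hpq (Or.inl q.2)
    -- The only order automorphism of `Fin n` is the identity.
    have := Subsingleton.elim (hσ.orderIsoOfSurjective σ σ.surjective) (OrderIso.refl _)
    ext1 p
    exact congrArg (fun f : Fin n ≃o Fin n => f p) this
  · rintro rfl p q hpq -
    exact hpq

/-- For `j < n` the outer map has arity `n - j + 1 ≥ 2` and vanishes; for `j = n` the identity is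
the only unshuffle. -/
theorem unshuffleSum_of_arity_one {K V W : Type*} [Field K] [AddCommGroup V] [Module K V]
    [AddCommGroup W] [Module K W] (φ : (i : ℕ) → MultilinearMap K (fun _ : Fin i => V) W)
    (μ : (i : ℕ) → MultilinearMap K (fun _ : Fin i => V) V) (hφ : ∀ i, 2 ≤ i → φ i = 0)
    {n : ℕ} (d : Fin n → ℤ) (a : Fin n → V) :
    unshuffleSum φ μ d a = φ 1 (fun _ => μ n a) := by
  have aux : ∀ (k : ℕ) (_ : k = 0) (x : V) (v : Fin k → V),
      φ (k + 1) (Fin.cons x v) = φ 1 (fun _ => x) := by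
    rintro _ rfl x v
    congr 1
    funext r
    rw [show r = 0 from Fin.fin_one_eq_zero r]
    rfl
  unfold unshuffleSum
  rw [Finset.sum_eq_single (Fin.last n)]
  · change ∑ σ ∈ unshuffles n n, _ = _
    rw [unshuffles_self, Finset.sum_singleton, koszulSign_one, aux _ (by simp)]
    simp only [Fin.val_last, Nat.sub_self, pow_zero, mul_one, one_smul]
    rfl
  · intro j _ hj
    have hj' : j.val < n := Fin.val_lt_last hj
    refine Finset.sum_eq_zero fun σ _ => ?_
    rw [hφ _ (by omega), zero_apply, smul_zero]
  · simp

theorem zetaSign_ones {n : ℕ} (σ : Equiv.Perm (Fin n)) (d : Fin n → ℤ) :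
    zetaSign (Composition.ones n) σ d = 1 := by
  unfold zetaSign
  simp only [Composition.ones_blocksFun, Nat.cast_one, sub_self, zero_mul,
    Finset.sum_const_zero, add_zero, one_mul]
  rw [← Finset.sum_add_distrib]
  refine Int.negOnePow_even _ (Finset.even_sum _ fun m _ => ?_)
  rw [← Finset.sum_filter, Finset.sum_const, Finset.filter_lt_eq_Ioi, Fin.card_Ioi]
  have := m.2
  -- With all `k_m = 1`, the pairs `m < m'` with fixed `m` number `j - 1 - m`, the same as the
  -- second summand of the exponent, so each `m` contributes twice this number.
  refine ⟨((Composition.ones n).length : ℤ) - 1 - m.val, ?_⟩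
  rw [nsmul_one]
  congr 1
  omega

theorem blockUnshuffles_ones (n : ℕ) : blockUnshuffles (Composition.ones n) = Finset.univ := by
  refine Finset.filter_true_of_mem fun σ _ m p q hpq => ?_
  have hp := p.2.trans_eq (Composition.ones_blocksFun n m)
  have hq := q.2.trans_eq (Composition.ones_blocksFun n m)
  have : p.val < q.val := hpq
  omega

theorem Composition.ones_embedding_eq_cast {n : ℕ} (m : Fin (Composition.ones n).length)
    (r : Fin ((Composition.ones n).blocksFun m)) :
    (Composition.ones n).embedding m r = Fin.cast (Composition.ones_length n) m := by
  have hr := r.2.trans_eq (Composition.ones_blocksFun n m)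
  have : r = ⟨0, by simp⟩ := Fin.ext (by simpa using hr)
  rw [this, Composition.ones_embedding]
  rfl

namespace LInftyAlgebra

/-- Every permutation is a block unshuffle here, and graded antisymmetry makes all `n!` terms equal.
Characteristic zero allows the cancellation against `1/n!`. -/
theorem blockSum_ones {K V W : Type*} [Field K] [CharZero K] [AddCommGroup V] [Module K V]
    (L : LInftyAlgebra K V) {n : ℕ} (e : W → V)
    (F : (m : Fin (Composition.ones n).length) → (Fin ((Composition.ones n).blocksFun m) → ℤ) →
      (Fin ((Composition.ones n).blocksFun m) → W) → V)
    (hF : ∀ m d b r, F m d b = e (b r)) (d : Fin n → ℤ) (a : Fin n → W)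
    (ha : ∀ r, e (a r) ∈ L.deg (d r)) :
    blockSum L.μ (Composition.ones n) F d a = L.μ n (fun r => e (a r)) := by
  have aux : ∀ (l : ℕ) (h : l = n) (v : Fin n → V),
      L.μ l (fun m => v (Fin.cast h m)) = L.μ n v := by
    rintro _ rfl v
    rfl
  have hterm : ∀ σ ∈ blockUnshuffles (Composition.ones n),
      (koszulSign σ d * zetaSign (Composition.ones n) σ d) • L.μ (Composition.ones n).length
        (fun m => F m (fun r => d (σ ((Composition.ones n).embedding m r)))
          (fun r => a (σ ((Composition.ones n).embedding m r))))
      = L.μ n (fun r => e (a r)) := by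
    intro σ _
    rw [zetaSign_ones, mul_one, L.μ_antisymm n d _ ha σ,
      ← aux _ (Composition.ones_length n) (fun r => e (a (σ r)))]
    congr 2
    funext m
    rw [hF m _ _ ⟨0, by simp⟩, Composition.ones_embedding_eq_cast]
  unfold blockSum
  rw [Finset.sum_congr rfl hterm, blockUnshuffles_ones, Finset.sum_const, Finset.card_univ,
    Fintype.card_perm, Fintype.card_fin, Composition.ones_length, ← Nat.cast_smul_eq_nsmul K,
    inv_smul_smul₀ (Nat.cast_ne_zero.2 n.factorial_ne_zero)]

/-- A composition other than the one into ones has a block of length at least two, which feeds a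
zero argument into the product. -/
theorem blockSum_of_arity_one {K V W : Type*} [Field K] [CharZero K] [AddCommGroup V]
    [Module K V] (L : LInftyAlgebra K V) (e : W → V)
    (E : (i : ℕ) → (Fin i → ℤ) → (Fin i → W) → V) (hE : ∀ d b, E 1 d b = e (b 0))
    (hE' : ∀ i, 2 ≤ i → ∀ d b, E i d b = 0) {n : ℕ} (c : Composition n) (d : Fin n → ℤ)
    (a : Fin n → W) (ha : ∀ r, e (a r) ∈ L.deg (d r)) :
    blockSum L.μ c (fun m => E (c.blocksFun m)) d a =
      if c = Composition.ones n then L.μ n (fun r => e (a r)) else 0 := by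
  split_ifs with hc
  · subst hc
    have aux : ∀ (k : ℕ) (_ : k = 1) (d : Fin k → ℤ) (b : Fin k → W) (r : Fin k),
        E k d b = e (b r) := by
      rintro _ rfl d b r
      rw [hE, Subsingleton.elim r 0]
    exact L.blockSum_ones e _ (fun m => aux _ (Composition.ones_blocksFun n m)) d a ha
  · obtain ⟨i, hi, hi'⟩ := Composition.ne_ones_iff.1 hc
    obtain ⟨m, rfl⟩ := List.mem_iff_get.1 hi
    unfold blockSum
    rw [Finset.sum_eq_zero, smul_zero]
    intro σ _
    rw [(L.μ c.length).map_coord_zero m (hE' _ hi' _ _), smul_zero]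

end LInftyAlgebra

/-! ## Transfer along a strict projection onto a subalgebra -/

theorem blockSum_mem {K V W : Type*} [Field K] [AddCommGroup V] [Module K V]
    {L : LInftyAlgebra K V} (S : L.Subalgebra) {n : ℕ} (c : Composition n)
    (F : (m : Fin c.length) → (Fin (c.blocksFun m) → ℤ) → (Fin (c.blocksFun m) → W) → V)
    (hF : ∀ m d b, F m d b ∈ S.carrier) (d : Fin n → ℤ) (a : Fin n → W) :
    blockSum L.μ c F d a ∈ S.carrier := by
  refine S.carrier.smul_mem _ (S.carrier.sum_mem fun σ _ => ?_)
  rw [Units.smul_def]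
  exact zsmul_mem (S.closed _ _ fun m => hF _ _ _) _

/-- Membership is carried through the induction together with vanishing: it is what lets closure of
the subalgebra place the argument of `h` where `h` is zero. -/
theorem transferEmbedding_mem_and_eq_zero {K V : Type*} [Field K] [AddCommGroup V] [Module K V]
    {L : LInftyAlgebra K V} (S : L.Subalgebra) {h : V →ₗ[K] V}
    (he : ∀ x ∈ S.carrier, h x = 0) (i : ℕ) (d : Fin i → ℤ) (b : Fin i → S.carrier) :
    transferEmbedding L S.carrier.subtype h i d b ∈ S.carrier ∧
      (2 ≤ i → transferEmbedding L S.carrier.subtype h i d b = 0) := by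
  induction i using Nat.strong_induction_on with
  | _ i ih =>
    match i with
    | 0 => rw [transferEmbedding]; exact ⟨zero_mem _, fun h => by omega⟩
    | 1 => rw [transferEmbedding]; exact ⟨(b 0).2, fun h => by omega⟩
    | n + 2 =>
      have h0 : transferEmbedding L S.carrier.subtype h (n + 2) d b = 0 := by
        rw [transferEmbedding, Finset.sum_eq_zero, neg_zero]
        exact fun c _ => he _ (blockSum_mem S c.1 _
          (fun m d' b' => (ih _ (c.1.blocksFun_lt_of_two_le c.2 m) d' b').1) d b)
      rw [h0]
      exact ⟨zero_mem _, fun _ => rfl⟩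

theorem transferProduct_eq {K V : Type*} [Field K] [CharZero K] [AddCommGroup V] [Module K V]
    {L : LInftyAlgebra K V} (S : L.Subalgebra) {p : V →ₗ[K] S.carrier} {h : V →ₗ[K] V}
    (hpe : ∀ x : S.carrier, p x = x) (he : ∀ x ∈ S.carrier, h x = 0) {i : ℕ} (hi : 2 ≤ i)
    (d : Fin i → ℤ) (b : Fin i → S.carrier) (hb : ∀ r, (b r : V) ∈ L.deg (d r)) :
    transferProduct L p S.carrier.subtype h i d b = S.restrictedProduct i b := by
  have key := fun c => L.blockSum_of_arity_one (S.carrier.subtype)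
    (transferEmbedding L S.carrier.subtype h) (fun d b => by rw [transferEmbedding])
    (fun i hi d b => (transferEmbedding_mem_and_eq_zero S he i d b).2 hi) c d b hb
  unfold transferProduct
  -- The composition into ones has length `i`, so it is among the summands because `i ≥ 2`.
  rw [Finset.sum_eq_single ⟨Composition.ones i, by simpa using hi⟩]
  · rw [key, if_pos rfl]
    exact hpe (S.restrictedProduct i b)
  · intro c _ hc
    rw [key, if_neg (fun h => hc (Subtype.ext h)), map_zero]
  · simp

namespace LInftyAlgebra

/-- A linear map, regarded as a family of multilinear maps concentrated in arity one. -/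
def linearFamily {K V W : Type*} [Field K] [AddCommGroup V] [Module K V] [AddCommGroup W]
    [Module K W] (f : V →ₗ[K] W) : (i : ℕ) → MultilinearMap K (fun _ : Fin i => V) W
  | 0 => 0
  | 1 => MultilinearMap.ofSubsingleton K V W (0 : Fin 1) f
  | _ + 2 => 0

theorem linearFamily_of_two_le {K V W : Type*} [Field K] [AddCommGroup V] [Module K V]
    [AddCommGroup W] [Module K W] (f : V →ₗ[K] W) : ∀ i, 2 ≤ i → linearFamily f i = 0
  | 0, h => by omega
  | 1, h => by omega
  | _ + 2, _ => rfl

/-- A strict morphism, regarded as a morphism without higher components. -/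
def IsStrictMorphism.toMorphism {K V W : Type*} [Field K] [CharZero K] [AddCommGroup V]
    [Module K V] [AddCommGroup W] [Module K W] {L : LInftyAlgebra K V} {M : LInftyAlgebra K W}
    {f : V →ₗ[K] W} (hf : IsStrictMorphism L M f) : Morphism L M where
  φ := linearFamily f
  φ_zero := rfl
  φ_mem
    | 0, _, _, _ => zero_mem _
    | 1, d, a, ha => by
      have h : f (a 0) ∈ M.deg (d 0) := hf.isCochainMap.map_deg (d 0) (a 0) (ha 0)
      simpa [linearFamily] using h
    | _ + 2, _, _, _ => zero_mem _
  φ_antisymm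
    | 0, _, _, _, _ => (smul_zero _).symm
    | 1, d, a, _, σ => by
      rw [Subsingleton.elim σ 1, koszulSign_one, one_smul]
      rfl
    | _ + 2, _, _, _, _ => (smul_zero _).symm
  -- Both sides collapse to one term, and the identity becomes strictness of `f`.
  compat i d a ha := by
    have key := fun c => M.blockSum_of_arity_one f (fun i _ => linearFamily f i)
      (fun _ _ => rfl) (fun i hi _ _ => by rw [linearFamily_of_two_le f i hi]; rfl) c d a
      (fun r => hf.isCochainMap.map_deg _ _ (ha r))
    rw [unshuffleSum_of_arity_one _ _ (linearFamily_of_two_le f),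
      Finset.sum_congr rfl fun c _ => key c, Finset.sum_ite_eq' Finset.univ,
      if_pos (Finset.mem_univ _), hf.map_μ]
    rfl

end LInftyAlgebra

theorem mainTheorem3 {K V : Type*} [Field K] [CharZero K] [AddCommGroup V] [Module K V]
    (Lhat : LInftyAlgebra K V) (L : Lhat.Subalgebra)
    (hquasi : IsQuasiIsoOfComplexes L.toLInftyAlgebra.complex Lhat.complex L.carrier.subtype)
    (p : V →ₗ[K] L.carrier)
    (hp : LInftyAlgebra.IsStrictMorphism Lhat L.toLInftyAlgebra p)
    (hproj : p ∘ₗ L.carrier.subtype = LinearMap.id) :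
    ∃ (h : V →ₗ[K] V) (M : LInftyAlgebra K L.carrier) (E : LInftyAlgebra.Morphism M Lhat),
      IsHomotopyTransfer Lhat L.toLInftyAlgebra.complex p L.carrier.subtype h M E ∧
      (∀ i : ℕ, 2 ≤ i → E.φ i = 0) ∧
      M = L.toLInftyAlgebra := by
  obtain ⟨h, hh⟩ := hquasi.exists_isSpecialDeformationRetract hp.isCochainMap hproj
  have he : ∀ x ∈ L.carrier, h x = 0 := fun x hx => LinearMap.congr_fun hh.h_comp_e ⟨x, hx⟩
  have hincl : LInftyAlgebra.IsStrictMorphism L.toLInftyAlgebra Lhat L.carrier.subtype :=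
    ⟨hquasi.1, fun _ _ => rfl⟩
  -- The restricted structure and the inclusion already satisfy the axioms, so only agreement with
  -- the transfer formulas is left.
  refine ⟨h, L.toLInftyAlgebra, hincl.toMorphism, ⟨hh, rfl, ?_, ?_, hquasi⟩,
    LInftyAlgebra.linearFamily_of_two_le _, rfl⟩
  · intro i hi d b hb
    exact (transferProduct_eq L (fun x => LinearMap.congr_fun hproj x) he hi d b hb).symm
  · intro i hi d b hb
    match i, hi with
    | 1, _ => rw [transferEmbedding]; rfl
    | n + 2, _ =>
      rw [(transferEmbedding_mem_and_eq_zero L he (n + 2) d b).2 (by omega)]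
      rfl
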